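/- Let $(W,d)$ be a Hilbert complex: real Hilbert spaces $W^k$ ($k\in\mathbb Z$) with inner products $\langle\cdot,\cdot\rangle$ and norms $\|\cdot\|$, and closed, densely defined linear maps $d^k$ from $W^k$ into $W^{k+1}$ with domain $V^k$, such that $d^kV^k\subset V^{k+1}$ and $d^{k+1}\circ d^k=0$ on $V^k$. For $v\in V^k$ put $\|v\|_V=(\|v\|^2+\|dv\|^2)^{1/2}$. Assume the compactness property: for each $k$, the intersection of $V^k$ with the domain $V^*_k$ of the adjoint of $d^{k-1}$, with its graph norm, is compactly embedded in $W^k$. Let $\mathfrak Z^k=\ker d^k$, let $\mathfrak Z^{k\perp}$ be its orthogonal complement, and let $\mathfrak H^k=\{q\in\mathfrak Z^k:\langle q,d\tau\rangle=0\ \forall\tau\in V^{k-1}\}$. The Poincaré constant in degree $k$ is the infimum of all $c\ge0$ such that $\|v\|_V\le c\,\|dv\|$ for all $v\in V^k\cap\mathfrak Z^{k\perp}$. For each $k$ let $V_h^k\subset V^k$ be a finite-dimensional subspace, with $dV_h^k\subset V_h^{k+1}$, and let $\pi_h:V^k\to V_h^k$ be linear operators, bounded in $\|\cdot\|_V$,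 with $d\pi_h=\pi_hd$ (they need not be projections). Let $\mathfrak Z_h^k=\mathfrak Z^k\cap V_h^k$, let $\mathfrak Z_h^{k\perp}$ be its orthogonal complement in $V_h^k$, and let $\mathfrak H_h^k=\{q\in\mathfrak Z_h^k:\langle q,d\tau\rangle=0\ \forall\tau\in V_h^{k-1}\}$. Fix a degree $k$ and assume that $\dim\mathfrak H_h^k=\dim\mathfrak H^k$. Let $f\in W^k$, let $(\sigma,u,p)\in V^{k-1}\times V^k\times\mathfrak H^k$ satisfy $$\langle\sigma,\tau\rangle-\langle d\tau,u\rangle=0,\qquad \langle d\sigma,v\rangle+\langle du,dv\rangle+\langle v,p\rangle=\langle f,v\rangle,\qquad \langle u,q\rangle=0$$ for all $(\tau,v,q)\in V^{k-1}\times V^k\times\mathfrak H^k$, and let $(\sigma_h,u_h,p_h)\in V_h^{k-1}\times V_h^k\times\mathfrak H_h^k$ satisfy the same equations for all $(\tau,v,q)\in V_h^{k-1}\times V_h^k\times\mathfrak H_h^k$. Put $e_\sigma=\sigma-\sigma_h$, $e_u=u-u_h$, $e_p=p-p_h$. Let $u_h^\perp$ be the orthogonal projection of $u_h$ onto $\mathfrak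 Z_h^{k\perp}$, and $P_{\mathfrak Z^\perp}$ the orthogonal projection onto $\mathfrak Z^{k\perp}$. For all $K$ and all $c>0$ there is a constant $C>0$, depending only on $K$ and $c$, such that the following holds in every situation as above in which the Poincaré constants in degrees $k-1$ and $k$ are at most $K$. There are $(\tau,v,q)\in V^{k-1}\times V^k\times\mathfrak H^k$ with $\|\tau\|_V+\|v\|_V+\|q\|=1$ (unless $V^{k-1}$ and $V^k$ are both $0$) and $\phi\in V^{k-1}$ with $\|\phi\|_V=1$ (unless $V^{k-1}=0$) such that, for every orthonormal basis $\{q_1,\dots,q_M\}$ of $\mathfrak H_h^k$ and all $\mu_1,\dots,\mu_M\in\mathbb R$ with $$\langle q_i,d(\psi-\pi_h\psi)\rangle\le c\,\mu_i\quad\text{for all }\psi\in V^{k-1}\text{ with }\|\psi\|_V=1,\qquad i=1,\dots,M,$$ and with $\mu=(\sum_{i=1}^M\mu_i^2)^{1/2}$: 1. $$\begin{aligned}\|e_\sigma\|_V+\|e_u\|_V+\|e_p\|\le C\Big(&|\langle e_\sigma,\tau-\pi_h\tau\rangle-\langle d(\tau-\pi_h\tau),e_u\rangle|\\&+|\langle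 f-d\sigma_h-p_h,v-\pi_hv\rangle-\langle du_h,d(v-\pi_hv)\rangle|\\&+|\langle p_h,d(\phi-\pi_h\phi)\rangle|+\mu\,\|u_h^\perp-P_{\mathfrak Z^\perp}u_h^\perp\|\Big);\end{aligned}$$ 2. $\|u_h^\perp-P_{\mathfrak Z^\perp}u_h^\perp\|\le\|u_h\|$; 3. for every $\epsilon\ge0$ with $\langle u_h^\perp,d(\psi-\pi_h\psi)\rangle\le c\,\epsilon$ for all $\psi\in V^{k-1}$ with $\|\psi\|_V=1$, $$\mu\,\|u_h^\perp-P_{\mathfrak Z^\perp}u_h^\perp\|\le C\,(\mu\,\epsilon+\mu^2\|u_h\|).$$ -/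

import Mathlib

/-- A Hilbert complex: closed, densely defined linear maps `d k` from `W k` into `W (k + 1)`, such
that the range of `d k` lies in the domain of `d (k + 1)` and `d (k + 1) ∘ d k = 0`.
The spaces `W k` are indexed by all integers; a bounded complex is extended by zero spaces. -/
structure HilbertComplex (W : ℤ → Type*) [∀ k, NormedAddCommGroup (W k)]
    [∀ k, InnerProductSpace ℝ (W k)] where
  d : ∀ k, W k →ₗ.[ℝ] W (k + 1)
  dense_domain : ∀ k, Dense ((d k).domain : Set (W k))
  isClosed : ∀ k, (d k).IsClosed
  range_le : ∀ k (v : (d k).domain), d k v ∈ (d (k + 1)).domain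
  d_comp_d : ∀ k (v : (d k).domain), d (k + 1) ⟨d k v, range_le k v⟩ = 0

namespace HilbertComplex

variable {W : ℤ → Type*} [∀ k, NormedAddCommGroup (W k)] [∀ k, InnerProductSpace ℝ (W k)]

/-- The space `V^k`, the domain of `d k`. As a subspace of `W k` it carries the inner product
and the norm of `W k`; its graph norm is `vnorm`. -/
abbrev V (X : HilbertComplex W) (k : ℤ) : Submodule ℝ (W k) := (X.d k).domain

/-- The differential of the domain complex, `V^k → V^(k+1)`. -/
def D (X : HilbertComplex W) (k : ℤ) : X.V k →ₗ[ℝ] X.V (k + 1) :=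
  (X.d k).toFun.codRestrict (X.V (k + 1)) (X.range_le k)

/-- The graph norm `‖v‖_V`, with `‖v‖_V ^ 2 = ‖v‖ ^ 2 + ‖d v‖ ^ 2`. -/
noncomputable def vnorm (X : HilbertComplex W) {k : ℤ} (v : X.V k) : ℝ :=
  Real.sqrt (‖v‖ ^ 2 + ‖X.D k v‖ ^ 2)

/-- The kernel `ℤ^k` of `d k`, as a subspace of `W k`. -/
noncomputable def Z (X : HilbertComplex W) (k : ℤ) : Submodule ℝ (W k) :=
  (LinearMap.ker (X.D k)).map (X.V k).subtype

/-- The harmonic forms of degree `k + 1`: the elements of the kernel of `d (k + 1)` that are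
`W`-orthogonal to the range of `d k`. -/
noncomputable def harmonic (X : HilbertComplex W) (k : ℤ) : Submodule ℝ (X.V (k + 1)) :=
  LinearMap.ker (X.D (k + 1)) ⊓ (LinearMap.range (X.D k))ᗮ

/-- The compactness property: in every degree `k + 1`, the intersection of `V^(k+1)` with the
domain of the Hilbert space adjoint of `d k`, with its graph norm, is compactly embedded
in `W (k + 1)`, that is, its unit ball is relatively compact in `W (k + 1)`. -/
def CompactnessProperty [∀ k, CompleteSpace (W k)] (X : HilbertComplex W) : Prop :=
  ∀ k : ℤ, IsCompact (closure {w : W (k + 1) |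
    ∃ (h : w ∈ X.V (k + 1)) (h' : w ∈ (X.d k).adjoint.domain),
      ‖w‖ ^ 2 + ‖X.D (k + 1) ⟨w, h⟩‖ ^ 2 + ‖(X.d k).adjoint ⟨w, h'⟩‖ ^ 2 ≤ 1})

/-- The best constant `c` in the Poincaré inequality `‖v‖_V ≤ c ‖d v‖` for all `v ∈ V^k`
orthogonal to the kernel of `d k`. -/
noncomputable def poincareConst (X : HilbertComplex W) (k : ℤ) : ℝ :=
  sInf {c : ℝ | 0 ≤ c ∧ ∀ v : X.V k, (v : W k) ∈ (X.Z k)ᗮ → X.vnorm v ≤ c * ‖X.D k v‖}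

/-- A subcomplex of finite-dimensional subspaces `Vh k` of `V^k`, mapped into one another
by `d`. -/
structure Subcomplex (X : HilbertComplex W) where
  Vh : ∀ k, Submodule ℝ (X.V k)
  finiteDimensional : ∀ k, FiniteDimensional ℝ (Vh k)
  map_mem : ∀ k, ∀ v ∈ Vh k, X.D k v ∈ Vh (k + 1)

namespace Subcomplex

variable {X : HilbertComplex W}

instance (S : X.Subcomplex) (k : ℤ) : FiniteDimensional ℝ (S.Vh k) := S.finiteDimensional k

/-- The kernel of `d` in `Vh k`. -/
def Zh (S : X.Subcomplex) (k : ℤ) : Submodule ℝ (X.V k) :=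
  S.Vh k ⊓ LinearMap.ker (X.D k)

/-- The orthogonal complement in `Vh k` of the discrete kernel. On the discrete kernel the inner
products of `W` and of `V` against any element of `V` agree, so either one may be used. -/
noncomputable def ZhPerp (S : X.Subcomplex) (k : ℤ) : Submodule ℝ (X.V k) :=
  S.Vh k ⊓ (S.Zh k)ᗮ

instance (S : X.Subcomplex) (k : ℤ) : FiniteDimensional ℝ (S.ZhPerp k) :=
  inferInstanceAs (FiniteDimensional ℝ (S.Vh k ⊓ (S.Zh k)ᗮ : Submodule ℝ (X.V k)))

/-- The discrete harmonic forms of degree `k + 1`: the elements of the discrete kernel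
that are orthogonal to `d (Vh k)`. -/
noncomputable def harmonic (S : X.Subcomplex) (k : ℤ) : Submodule ℝ (X.V (k + 1)) :=
  S.Zh (k + 1) ⊓ ((S.Vh k).map (X.D k))ᗮ

/-- The component `u^⊥` of an element `u` of `Vh k` in the orthogonal complement in `Vh k` of the
discrete kernel. -/
noncomputable def perpPart (S : X.Subcomplex) {k : ℤ} (u : X.V k) : X.V k :=
  (S.ZhPerp k).starProjection u

/-- A `V`-bounded linear cochain operator `π` from the domain complex to the subcomplex. It need
not be a projection. -/
structure CochainOperator (S : X.Subcomplex) where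
  toFun : ∀ k, X.V k →ₗ[ℝ] S.Vh k
  bounded : ∀ k, ∃ c : ℝ, ∀ v : X.V k, X.vnorm (toFun k v : X.V k) ≤ c * X.vnorm v
  comm : ∀ k (v : X.V k), X.D k (toFun k v : X.V k) = (toFun (k + 1) (X.D k v) : X.V (k + 1))

/-- The error `v - π v`. -/
def CochainOperator.err {S : X.Subcomplex} (π : S.CochainOperator) {k : ℤ} (v : X.V k) : X.V k :=
  v - (π.toFun k v : X.V k)

end Subcomplex

/-- `(σ, u, p)` solves the weak mixed formulation of the Hodge Laplace problem in degree `k + 1`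
with data `f`. -/
structure IsSolution (X : HilbertComplex W) {k : ℤ} (f : W (k + 1))
    (σ : X.V k) (u p : X.V (k + 1)) : Prop where
  mem_harmonic : p ∈ X.harmonic k
  eq_sigma : ∀ τ : X.V k, inner ℝ σ τ - inner ℝ (X.D k τ) u = 0
  eq_u : ∀ v : X.V (k + 1), inner ℝ (X.D k σ) v + inner ℝ (X.D (k + 1) u) (X.D (k + 1) v)
    + inner ℝ v p = inner ℝ f (v : W (k + 1))
  orthogonal : ∀ q ∈ X.harmonic k, inner ℝ u q = 0

/-- `(σh, uh, ph)` solves the discrete weak mixed formulation on the subcomplex in degree `k + 1`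
with data `f`. -/
structure Subcomplex.IsSolution {X : HilbertComplex W} (S : X.Subcomplex) {k : ℤ} (f : W (k + 1))
    (σh : X.V k) (uh ph : X.V (k + 1)) : Prop where
  mem_sigma : σh ∈ S.Vh k
  mem_u : uh ∈ S.Vh (k + 1)
  mem_harmonic : ph ∈ S.harmonic k
  eq_sigma : ∀ τ ∈ S.Vh k, inner ℝ σh τ - inner ℝ (X.D k τ) uh = 0
  eq_u : ∀ v ∈ S.Vh (k + 1), inner ℝ (X.D k σh) v
    + inner ℝ (X.D (k + 1) uh) (X.D (k + 1) v) + inner ℝ v ph = inner ℝ f (v : W (k + 1))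
  orthogonal : ∀ q ∈ S.harmonic k, inner ℝ uh q = 0

/-- The `W`-norm of `w - P w`, where `P` is the orthogonal projection onto the orthogonal
complement of the kernel of `d k`. -/
noncomputable def distZPerp [∀ k, CompleteSpace (W k)] (X : HilbertComplex W) {k : ℤ}
    (w : X.V k) : ℝ :=
  ‖(w : W k) - (X.Z k)ᗮ.starProjection (w : W k)‖

end HilbertComplex

/-! The continuous mixed form is inf-sup stable with a constant depending only on the Poincaré
constants (`exists_infSup`). It is applied to the error, but `p - ph` need not be harmonic, so `ph`
is first split as `D ρ + h` with `h` harmonic, and stability is used for `(σ - σh, u - uh, p - h)`.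
Galerkin orthogonality (`mixedForm_error`) turns the form into the two residuals plus two
nonconformity terms, `⟪v, D ρ⟫` and `⟪uh, q⟫`.

The first is controlled because `ph` is orthogonal to `D (Vh)`: pairing it with `D ρ` is the same as
pairing it with `D (ρ - π ρ)`, and the Poincaré inequality bounds `ρ` by `D ρ` (`norm_D_le`). The
test form `φ` is the normalized `ρ`.

For the second, `uh` differs from its perpendicular part by a discrete boundary, which harmonic
forms do not see. That part is also orthogonal to discrete harmonic forms, so `q` may be replaced by
`q - P q`, with `P` the projection onto them; only its distance to `Zᗮ` then matters. The hypothesis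
on `μ` bounds how far discrete harmonic forms are from harmonic ones; equality of dimensions
reverses the direction, because the Hilbert-Schmidt gap is symmetric
(`sum_norm_sq_sub_starProjection_comm`). -/

namespace HilbertComplex

open Filter Topology

variable {W : ℤ → Type*} [∀ k, NormedAddCommGroup (W k)] [∀ k, InnerProductSpace ℝ (W k)]

/-! ### Graph norm, cycles, boundaries and harmonic forms -/

section Basic

variable (X : HilbertComplex W)

theorem D_D {k : ℤ} (v : X.V k) : X.D (k + 1) (X.D k v) = 0 :=
  Subtype.ext (X.d_comp_d k v)

theorem vnorm_nonneg {k : ℤ} (v : X.V k) : 0 ≤ X.vnorm v := Real.sqrt_nonneg _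

theorem vnorm_sq {k : ℤ} (v : X.V k) : X.vnorm v ^ 2 = ‖v‖ ^ 2 + ‖X.D k v‖ ^ 2 :=
  Real.sq_sqrt (by positivity)

theorem norm_le_vnorm {k : ℤ} (v : X.V k) : ‖v‖ ≤ X.vnorm v :=
  Real.le_sqrt_of_sq_le (by nlinarith [sq_nonneg ‖X.D k v‖])

theorem norm_D_le_vnorm {k : ℤ} (v : X.V k) : ‖X.D k v‖ ≤ X.vnorm v :=
  Real.le_sqrt_of_sq_le (by nlinarith [sq_nonneg ‖v‖])

theorem vnorm_le_add {k : ℤ} (v : X.V k) : X.vnorm v ≤ ‖v‖ + ‖X.D k v‖ :=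
  (Real.sqrt_le_left (by positivity)).2 (by nlinarith [norm_nonneg v, norm_nonneg (X.D k v)])

theorem vnorm_smul {k : ℤ} (a : ℝ) (v : X.V k) : X.vnorm (a • v) = |a| * X.vnorm v := by
  have h : ‖a • v‖ ^ 2 + ‖X.D k (a • v)‖ ^ 2 = |a| ^ 2 * (‖v‖ ^ 2 + ‖X.D k v‖ ^ 2) := by
    rw [map_smul, norm_smul, norm_smul, Real.norm_eq_abs]; ring
  rw [vnorm, vnorm, h, Real.sqrt_mul (by positivity), Real.sqrt_sq (abs_nonneg a)]

@[simp]
theorem vnorm_zero {k : ℤ} : X.vnorm (0 : X.V k) = 0 := by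
  simp [vnorm]

theorem vnorm_eq_zero {k : ℤ} {v : X.V k} (h : X.vnorm v = 0) : v = 0 :=
  norm_le_zero_iff.1 (h ▸ X.norm_le_vnorm v)

theorem vnorm_inv_smul {k : ℤ} {v : X.V k} (h : X.vnorm v ≠ 0) :
    X.vnorm ((X.vnorm v)⁻¹ • v) = 1 := by
  rw [vnorm_smul, abs_of_nonneg (inv_nonneg.2 (X.vnorm_nonneg v)), inv_mul_cancel₀ h]

theorem exists_vnorm_eq_one {k : ℤ} [Nontrivial (X.V k)] : ∃ v : X.V k, X.vnorm v = 1 := by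
  obtain ⟨v, hv⟩ := exists_ne (0 : X.V k)
  exact ⟨_, X.vnorm_inv_smul fun h => hv (X.vnorm_eq_zero h)⟩

theorem mem_Z_iff {k : ℤ} {w : W k} : w ∈ X.Z k ↔ ∃ h : w ∈ X.V k, X.D k ⟨w, h⟩ = 0 := by
  simp [Z]

theorem coe_mem_Z {k : ℤ} {v : X.V k} : (v : W k) ∈ X.Z k ↔ X.D k v = 0 := by
  simp [mem_Z_iff]

theorem mem_graph_iff {k : ℤ} {w : W k} {y : W (k + 1)} :
    (w, y) ∈ (X.d k).graph ↔ ∃ h : w ∈ X.V k, (X.D k ⟨w, h⟩ : W (k + 1)) = y := by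
  rw [LinearPMap.mem_graph_iff]
  constructor
  · rintro ⟨v, rfl, rfl⟩
    exact ⟨v.2, rfl⟩
  · rintro ⟨h, rfl⟩
    exact ⟨⟨w, h⟩, rfl, rfl⟩

theorem isClosed_graph (k : ℤ) : IsClosed ((X.d k).graph : Set (W k × W (k + 1))) :=
  X.isClosed k

theorem isClosed_Z (k : ℤ) : IsClosed (X.Z k : Set (W k)) := by
  have h : (X.Z k : Set (W k)) = (fun w => (w, (0 : W (k + 1)))) ⁻¹' (X.d k).graph := by
    ext w
    simp only [SetLike.mem_coe, Set.mem_preimage, mem_Z_iff, mem_graph_iff]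
    simp
  rw [h]
  exact (X.isClosed_graph k).preimage (by fun_prop)

/-- The range of `d k`, as a subspace of `W (k + 1)`. -/
noncomputable def boundary (k : ℤ) : Submodule ℝ (W (k + 1)) := LinearMap.range (X.d k).toFun

theorem mem_boundary_iff {k : ℤ} {w : W (k + 1)} :
    w ∈ X.boundary k ↔ ∃ v : X.V k, (X.D k v : W (k + 1)) = w := Iff.rfl

theorem boundary_le_Z (k : ℤ) : X.boundary k ≤ X.Z (k + 1) := by
  rintro _ ⟨v, rfl⟩
  exact X.coe_mem_Z.2 (X.D_D v)

theorem mem_harmonic_iff {k : ℤ} {q : X.V (k + 1)} :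
    q ∈ X.harmonic k ↔ X.D (k + 1) q = 0 ∧ ∀ τ : X.V k, inner ℝ (X.D k τ) q = 0 := by
  rw [harmonic, Submodule.mem_inf, LinearMap.mem_ker, Submodule.mem_orthogonal]
  exact and_congr_right fun _ => ⟨fun h τ => h _ ⟨τ, rfl⟩, fun h _ ⟨τ, hτ⟩ => hτ ▸ h τ⟩

theorem inner_D_harmonic {k : ℤ} {q : X.V (k + 1)} (hq : q ∈ X.harmonic k) (τ : X.V k) :
    inner ℝ (X.D k τ) q = 0 := (X.mem_harmonic_iff.1 hq).2 τ

theorem D_harmonic {k : ℤ} {q : X.V (k + 1)} (hq : q ∈ X.harmonic k) :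
    X.D (k + 1) q = 0 := (X.mem_harmonic_iff.1 hq).1

theorem inner_eq_zero_of_mem_Z_orthogonal {k : ℤ} {y z : X.V (k + 1)} (hy : X.D (k + 1) y = 0)
    (hz : (z : W (k + 1)) ∈ (X.Z (k + 1))ᗮ) : inner ℝ y z = 0 :=
  (Submodule.mem_orthogonal _ _).1 hz _ (X.coe_mem_Z.2 hy)

end Basic

/-! ### The Poincaré inequality from compactness -/

section Poincare

variable [∀ k, CompleteSpace (W k)] {X : HilbertComplex W}

instance (k : ℤ) : CompleteSpace (X.Z k) := (X.isClosed_Z k).completeSpace_coe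

/-- Boundaries are cycles, so `w` annihilates the range of `d k`. Hence on `Zᗮ` the graph norm in
the compactness property reduces to the `V`-norm. -/
theorem adjoint_of_mem_Z_orthogonal {k : ℤ} {w : W (k + 1)} (hw : w ∈ (X.Z (k + 1))ᗮ) :
    ∃ h : w ∈ (X.d k).adjoint.domain, (X.d k).adjoint ⟨w, h⟩ = 0 := by
  have h0 : ∀ x : (X.d k).domain, inner ℝ (0 : W k) (x : W k) = inner ℝ w (X.d k x) := by
    intro x
    rw [inner_zero_left, real_inner_comm]
    exact ((X.Z (k + 1)).mem_orthogonal w |>.1 hw _ (X.boundary_le_Z k ⟨x, rfl⟩)).symm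
  refine ⟨LinearPMap.mem_adjoint_domain_of_exists _ ⟨0, h0⟩, ?_⟩
  exact LinearPMap.adjoint_apply_eq (X.dense_domain k) ⟨w, _⟩ h0

/-- A violating sequence, normalized in `V`, has a subsequence converging in `W` while its
differentials tend to zero. By closedness of `d` the limit lies in both `Z` and `Zᗮ`, so it
vanishes, against the normalization. This makes the set in `poincareConst` nonempty, so that its
`sInf` is meaningful. -/
theorem exists_poincare (hX : X.CompactnessProperty) (k : ℤ) :
    ∃ c : ℝ, 0 ≤ c ∧ ∀ v : X.V k, (v : W k) ∈ (X.Z k)ᗮ → X.vnorm v ≤ c * ‖X.D k v‖ := by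
  obtain ⟨j, rfl⟩ : ∃ j, k = j + 1 := ⟨k - 1, by ring⟩
  by_contra! hcon
  have key : ∀ n : ℕ, ∃ w : X.V (j + 1), (w : W (j + 1)) ∈ (X.Z (j + 1))ᗮ ∧ X.vnorm w = 1 ∧
      ‖X.D (j + 1) w‖ ≤ 1 / ((n : ℝ) + 1) := by
    intro n
    obtain ⟨v, hv, hlt⟩ := hcon ((n : ℝ) + 1) (by positivity)
    have hpos : 0 < X.vnorm v := lt_of_le_of_lt (by positivity) hlt
    refine ⟨(X.vnorm v)⁻¹ • v, Submodule.smul_mem _ _ hv, X.vnorm_inv_smul hpos.ne', ?_⟩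
    rw [map_smul, norm_smul, Real.norm_eq_abs, abs_of_pos (inv_pos.2 hpos),
      le_div_iff₀ (by positivity), mul_assoc, inv_mul_le_iff₀ hpos]
    linarith
  choose w hwZ hw1 hwD using key
  have hmem : ∀ n, (w n : W (j + 1)) ∈ closure {w : W (j + 1) |
      ∃ (h : w ∈ X.V (j + 1)) (h' : w ∈ (X.d j).adjoint.domain),
        ‖w‖ ^ 2 + ‖X.D (j + 1) ⟨w, h⟩‖ ^ 2 + ‖(X.d j).adjoint ⟨w, h'⟩‖ ^ 2 ≤ 1} := by
    intro n
    obtain ⟨h', h0⟩ := adjoint_of_mem_Z_orthogonal (hwZ n)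
    refine subset_closure ⟨(w n).2, h', ?_⟩
    have := X.vnorm_sq (w n)
    rw [hw1] at this
    rw [h0, norm_zero]
    change ‖w n‖ ^ 2 + ‖X.D (j + 1) (w n)‖ ^ 2 + 0 ^ 2 ≤ 1
    linarith
  obtain ⟨a, -, φ, hφ, hlim⟩ := (hX j).tendsto_subseq hmem
  have hD : Tendsto (fun n => ‖X.D (j + 1) (w n)‖) atTop (𝓝 0) :=
    squeeze_zero (fun _ => norm_nonneg _) hwD tendsto_one_div_add_atTop_nhds_zero_nat
  have hD' : Tendsto (fun n => (X.D (j + 1) (w n) : W (j + 1 + 1))) atTop (𝓝 0) :=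
    tendsto_zero_iff_norm_tendsto_zero.2 hD
  have hgraph : (a, (0 : W (j + 1 + 1))) ∈ (X.d (j + 1)).graph :=
    (X.isClosed_graph (j + 1)).mem_of_tendsto
      (hlim.prodMk_nhds (hD'.comp hφ.tendsto_atTop))
      (Eventually.of_forall fun n => X.mem_graph_iff.2 ⟨(w (φ n)).2, rfl⟩)
  have haZ : a ∈ X.Z (j + 1) := by
    obtain ⟨h, h0⟩ := X.mem_graph_iff.1 hgraph
    exact X.mem_Z_iff.2 ⟨h, Subtype.ext h0⟩
  have haP : a ∈ (X.Z (j + 1))ᗮ :=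
    (Submodule.isClosed_orthogonal _).mem_of_tendsto hlim
      (Eventually.of_forall fun n => hwZ (φ n))
  have ha : a = 0 := inner_self_eq_zero.1 (Submodule.inner_right_of_mem_orthogonal haZ haP)
  have h1 : Tendsto (fun n => ‖(w (φ n) : W (j + 1))‖ ^ 2 + ‖X.D (j + 1) (w (φ n))‖ ^ 2) atTop
      (𝓝 (‖a‖ ^ 2 + 0 ^ 2)) := (hlim.norm.pow 2).add ((hD.comp hφ.tendsto_atTop).pow 2)
  have h2 : (fun n => ‖(w (φ n) : W (j + 1))‖ ^ 2 + ‖X.D (j + 1) (w (φ n))‖ ^ 2) = fun _ => 1 := by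
    funext n
    have := X.vnorm_sq (w (φ n))
    rw [hw1] at this
    rw [Submodule.norm_coe]
    linarith
  rw [h2, ha] at h1
  have := tendsto_nhds_unique h1 tendsto_const_nhds
  norm_num at this

theorem poincare (hX : X.CompactnessProperty) {k : ℤ} {K : ℝ} (hK : X.poincareConst k ≤ K)
    (v : X.V k) (hv : (v : W k) ∈ (X.Z k)ᗮ) : X.vnorm v ≤ K * ‖X.D k v‖ := by
  refine le_trans ?_ (mul_le_mul_of_nonneg_right hK (norm_nonneg _))
  -- Division by `‖D v‖` shows that the infimum is itself admissible; when `D v = 0`, any admissible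
  -- constant forces the left side to vanish.
  rcases (norm_nonneg (X.D k v)).eq_or_lt with h | h
  · obtain ⟨c, -, hc⟩ := exists_poincare hX k
    simpa [← h] using hc v hv
  · rw [← div_le_iff₀ h]
    exact le_csInf (exists_poincare hX k) fun c hc => (div_le_iff₀ h).2 (hc.2 v hv)

end Poincare

/-! ### Closed range and the Hodge decomposition -/

section Hodge

variable [∀ k, CompleteSpace (W k)] {X : HilbertComplex W} {k : ℤ} {K : ℝ}

theorem exists_potential (hP : ∀ v : X.V k, (v : W k) ∈ (X.Z k)ᗮ → X.vnorm v ≤ K * ‖X.D k v‖)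
    (ψ : X.V k) :
    ∃ ρ : X.V k, (ρ : W k) ∈ (X.Z k)ᗮ ∧ X.D k ρ = X.D k ψ ∧ X.vnorm ρ ≤ K * ‖X.D k ρ‖ := by
  obtain ⟨h, h0⟩ := X.mem_Z_iff.1 ((X.Z k).starProjection_apply_mem (ψ : W k))
  have hρ : ((ψ - ⟨_, h⟩ : X.V k) : W k) ∈ (X.Z k)ᗮ :=
    (X.Z k).sub_starProjection_mem_orthogonal (ψ : W k)
  exact ⟨ψ - ⟨_, h⟩, hρ, by rw [map_sub, h0, sub_zero], hP _ hρ⟩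

/-- Restricting the graph of `d` to `Zᗮ` gives a complete space with the same range, on which the
second coordinate is bounded below by the Poincaré inequality. -/
theorem isClosed_boundary
    (hP : ∀ v : X.V k, (v : W k) ∈ (X.Z k)ᗮ → X.vnorm v ≤ K * ‖X.D k v‖) :
    IsClosed (X.boundary k : Set (W (k + 1))) := by
  let G : Submodule ℝ (W k × W (k + 1)) :=
    (X.d k).graph ⊓ ((X.Z k)ᗮ).comap (LinearMap.fst ℝ (W k) (W (k + 1)))
  have hG : IsClosed (G : Set (W k × W (k + 1))) :=
    (X.isClosed_graph k).inter ((Submodule.isClosed_orthogonal (X.Z k)).preimage continuous_fst)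
  have : CompleteSpace G := hG.completeSpace_coe
  let F : G →ₗ[ℝ] W (k + 1) := (LinearMap.snd ℝ (W k) (W (k + 1))).comp G.subtype
  -- The product norm is a maximum: `K` handles the first coordinate and `1` the second.
  have hF : AntilipschitzWith (max K 1).toNNReal F := by
    refine AddMonoidHomClass.antilipschitz_of_bound F fun x => ?_
    obtain ⟨⟨w, y⟩, hg, hz⟩ := x
    obtain ⟨hw, rfl⟩ := X.mem_graph_iff.1 hg
    have h1 := hP ⟨w, hw⟩ hz
    have h2 := X.norm_le_vnorm ⟨w, hw⟩
    have h0 := norm_nonneg (X.D k ⟨w, hw⟩)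
    rw [Real.coe_toNNReal _ (le_trans zero_le_one (le_max_right _ _))]
    change max ‖(⟨w, hw⟩ : X.V k)‖ ‖X.D k ⟨w, hw⟩‖ ≤ max K 1 * ‖X.D k ⟨w, hw⟩‖
    refine max_le ((h2.trans h1).trans ?_) ?_
    · exact mul_le_mul_of_nonneg_right (le_max_left _ _) h0
    · nlinarith [le_max_right K 1]
  have hFc : UniformContinuous F :=
    uniformContinuous_snd.comp uniformContinuous_subtype_val
  have hr : (X.boundary k : Set (W (k + 1))) = Set.range F := by
    ext y
    constructor
    · rintro ⟨ψ, rfl⟩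
      obtain ⟨ρ, hρ, hD, -⟩ := exists_potential hP ψ
      refine ⟨⟨((ρ : W k), (X.D k ρ : W (k + 1))), X.mem_graph_iff.2 ⟨ρ.2, rfl⟩, hρ⟩, ?_⟩
      exact congrArg Subtype.val hD
    · rintro ⟨⟨⟨w, y⟩, hg, hz⟩, rfl⟩
      obtain ⟨hw, rfl⟩ := X.mem_graph_iff.1 hg
      exact ⟨⟨w, hw⟩, rfl⟩
  rw [hr]
  exact hF.isClosed_range hFc

/-- The Hodge decomposition, with a bounded potential of the component in the range of `d k`. -/
theorem exists_hodge (hP : ∀ v : X.V k, (v : W k) ∈ (X.Z k)ᗮ → X.vnorm v ≤ K * ‖X.D k v‖)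
    (u : X.V (k + 1)) :
    ∃ (ρ : X.V k) (h z : X.V (k + 1)), h ∈ X.harmonic k ∧ (z : W (k + 1)) ∈ (X.Z (k + 1))ᗮ ∧
      X.vnorm ρ ≤ K * ‖X.D k ρ‖ ∧ u = X.D k ρ + h + z := by
  have : CompleteSpace (X.boundary k) := (isClosed_boundary hP).completeSpace_coe
  set a : W (k + 1) := (X.Z (k + 1)).starProjection u with ha
  obtain ⟨haV, ha0⟩ := X.mem_Z_iff.1 ((X.Z (k + 1)).starProjection_apply_mem (u : W (k + 1)))
  obtain ⟨ψ, hψ⟩ := X.mem_boundary_iff.1 ((X.boundary k).starProjection_apply_mem a)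
  obtain ⟨ρ, -, hρ, hb⟩ := exists_potential hP ψ
  -- `a` is the projection of `u` onto the cycles and `D ρ` that of `a` onto the closed range; the
  -- two remainders are the other components.
  refine ⟨ρ, ⟨a, haV⟩ - X.D k ρ, u - ⟨a, haV⟩, X.mem_harmonic_iff.2 ⟨?_, fun τ => ?_⟩,
    (X.Z (k + 1)).sub_starProjection_mem_orthogonal (u : W (k + 1)), hb, by abel⟩
  · rw [map_sub, D_D, ha0, sub_zero]
  · have := (X.boundary k).sub_starProjection_mem_orthogonal a
    rw [← hψ] at this
    rw [hρ]
    exact (Submodule.mem_orthogonal _ _).1 this _ (X.mem_boundary_iff.2 ⟨τ, rfl⟩)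

/-- The Hodge decomposition of a closed form. -/
theorem exists_hodge_closed
    (hP : ∀ v : X.V k, (v : W k) ∈ (X.Z k)ᗮ → X.vnorm v ≤ K * ‖X.D k v‖)
    {u : X.V (k + 1)} (hu : X.D (k + 1) u = 0) :
    ∃ (ρ : X.V k) (h : X.V (k + 1)), h ∈ X.harmonic k ∧
      X.vnorm ρ ≤ K * ‖X.D k ρ‖ ∧ u = X.D k ρ + h := by
  obtain ⟨ρ, h, z, hh, hz, hρ, rfl⟩ := exists_hodge hP u
  have hz0 : X.D (k + 1) z = 0 := by
    simpa [D_D, D_harmonic X hh] using hu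
  have : z = 0 := inner_self_eq_zero.1 (X.inner_eq_zero_of_mem_Z_orthogonal hz0 hz)
  exact ⟨ρ, h, hh, hρ, by simp [this]⟩

end Hodge

end HilbertComplex
-- The gap between subspaces of equal finite dimension
section Gap

variable {E : Type*} [NormedAddCommGroup E] [InnerProductSpace ℝ E]

theorem norm_sq_sub_starProjection (A : Submodule ℝ E) [A.HasOrthogonalProjection] (x : E) :
    ‖x - A.starProjection x‖ ^ 2 = ‖x‖ ^ 2 - ‖A.starProjection x‖ ^ 2 := by
  have h : inner ℝ (x - A.starProjection x) (A.starProjection x) = 0 :=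
    A.starProjection_inner_eq_zero x _ (A.starProjection_apply_mem x)
  have := norm_add_sq_eq_norm_sq_add_norm_sq_of_inner_eq_zero _ _ h
  rw [sub_add_cancel] at this
  linarith

theorem norm_sq_starProjection_eq_sum {ι : Type*} [Fintype ι] (A : Submodule ℝ E)
    [FiniteDimensional ℝ A] (b : OrthonormalBasis ι ℝ A) (x : E) :
    ‖A.starProjection x‖ ^ 2 = ∑ i, inner ℝ (b i : E) x ^ 2 := by
  change ‖A.orthogonalProjectionOnto x‖ ^ 2 = _
  rw [← b.sum_sq_norm_inner_right]
  refine Finset.sum_congr rfl fun i _ => ?_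
  rw [Real.norm_eq_abs, sq_abs]
  congr 1
  have := A.starProjection_inner_eq_zero x _ (b i).2
  rw [inner_sub_left] at this
  rw [real_inner_comm, Submodule.coe_inner, real_inner_comm x]
  exact (sub_eq_zero.1 this).symm

/-- For two subspaces of the same finite dimension, the distance from one to the other in the
Hilbert-Schmidt norm is symmetric. -/
theorem sum_norm_sq_sub_starProjection_comm {ι : Type*} [Fintype ι] (A B : Submodule ℝ E)
    [FiniteDimensional ℝ A] [FiniteDimensional ℝ B] (a : OrthonormalBasis ι ℝ A)
    (b : OrthonormalBasis ι ℝ B) :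
    ∑ i, ‖(b i : E) - A.starProjection (b i)‖ ^ 2
      = ∑ i, ‖(a i : E) - B.starProjection (a i)‖ ^ 2 := by
  have ha : ∀ i, ‖(a i : E)‖ = 1 := fun i => a.norm_eq_one i
  have hb : ∀ i, ‖(b i : E)‖ = 1 := fun i => b.norm_eq_one i
  -- By Pythagoras and Parseval each side is the number of indices minus the double sum of squared
  -- inner products of the two bases.
  simp only [norm_sq_sub_starProjection, norm_sq_starProjection_eq_sum A a,
    norm_sq_starProjection_eq_sum B b, ha, hb, Finset.sum_sub_distrib]
  congr 1
  rw [Finset.sum_comm]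
  simp only [real_inner_comm]

/-- The hypothesis measures `A` against `B`, the conclusion `B` against `A`. Symmetry of the
Hilbert-Schmidt gap links them, and Cauchy-Schwarz over a basis of `B` passes to a general `q`. -/
theorem norm_sub_starProjection_le_of_basis {M : ℕ} {A B : Submodule ℝ E}
    [FiniteDimensional ℝ A] [FiniteDimensional ℝ B]
    (hAB : Module.finrank ℝ B = Module.finrank ℝ A) (a : OrthonormalBasis (Fin M) ℝ A)
    {m : Fin M → ℝ} (hm : ∀ i, ∃ h ∈ B, ‖(a i : E) - h‖ ≤ m i) {q : E} (hq : q ∈ B) :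
    ‖q - A.starProjection q‖ ≤ Real.sqrt (∑ i, m i ^ 2) * ‖q‖ := by
  have hM : Module.finrank ℝ B = M := by
    rw [hAB, Module.finrank_eq_card_basis a.toBasis, Fintype.card_fin]
  let b : OrthonormalBasis (Fin M) ℝ B := (stdOrthonormalBasis ℝ B).reindex (finCongr hM)
  have hsum : ∑ i, ‖(b i : E) - A.starProjection (b i)‖ ^ 2 ≤ ∑ i, m i ^ 2 := by
    rw [sum_norm_sq_sub_starProjection_comm A B a b]
    refine Finset.sum_le_sum fun i _ => ?_
    obtain ⟨h, hB, hle⟩ := hm i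
    refine pow_le_pow_left₀ (norm_nonneg _) (le_trans ?_ hle) 2
    rw [B.starProjection_minimal]
    exact ciInf_le ⟨0, by rintro _ ⟨x, rfl⟩; exact norm_nonneg _⟩ (⟨h, hB⟩ : B)
  have hqs : q = ∑ i, inner ℝ (b i : E) q • (b i : E) := by
    have := congrArg (Subtype.val) (b.sum_repr' ⟨q, hq⟩)
    simpa using this.symm
  have hqn : ∑ i, |inner ℝ (b i : E) q| ^ 2 = ‖q‖ ^ 2 := by
    have := b.sum_sq_norm_inner_right ⟨q, hq⟩
    simpa using this
  calc ‖q - A.starProjection q‖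
      = ‖∑ i, inner ℝ (b i : E) q • ((b i : E) - A.starProjection (b i))‖ := by
        congr 1
        conv_lhs => rw [hqs]
        simp only [map_sum, map_smul, smul_sub, Finset.sum_sub_distrib]
    _ ≤ ∑ i, |inner ℝ (b i : E) q| * ‖(b i : E) - A.starProjection (b i)‖ := by
        refine (norm_sum_le _ _).trans (le_of_eq ?_)
        simp only [norm_smul, Real.norm_eq_abs]
    _ ≤ Real.sqrt (∑ i, |inner ℝ (b i : E) q| ^ 2)
          * Real.sqrt (∑ i, ‖(b i : E) - A.starProjection (b i)‖ ^ 2) :=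
        Real.sum_mul_le_sqrt_mul_sqrt _ _ _
    _ ≤ ‖q‖ * Real.sqrt (∑ i, m i ^ 2) := by
        rw [hqn, Real.sqrt_sq (norm_nonneg _)]
        exact mul_le_mul_of_nonneg_left (Real.sqrt_le_sqrt hsum) (norm_nonneg _)
    _ = _ := mul_comm _ _

end Gap

namespace HilbertComplex

variable {W : ℤ → Type*} [∀ k, NormedAddCommGroup (W k)] [∀ k, InnerProductSpace ℝ (W k)]

/-- The bilinear form of the mixed formulation. -/
noncomputable def mixedForm (X : HilbertComplex W) {k : ℤ} (s : X.V k) (e r : X.V (k + 1))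
    (τ : X.V k) (v q : X.V (k + 1)) : ℝ :=
  inner ℝ s τ - inner ℝ (X.D k τ) e + (inner ℝ (X.D k s) v
    + inner ℝ (X.D (k + 1) e) (X.D (k + 1) v) + inner ℝ v r) - inner ℝ e q

theorem mixedForm_smul {X : HilbertComplex W} {k : ℤ} (s : X.V k) (e r : X.V (k + 1)) (a : ℝ) (τ : X.V k) (v q : X.V (k + 1)) :
    X.mixedForm s e r (a • τ) (a • v) (a • q) = a * X.mixedForm s e r τ v q := by
  simp only [mixedForm, map_smul, real_inner_smul_left, real_inner_smul_right]
  ring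

theorem add_three_sq_le (a b c : ℝ) : (a + b + c) ^ 2 ≤ 3 * (a ^ 2 + b ^ 2 + c ^ 2) := by
  nlinarith [sq_nonneg (a - b), sq_nonneg (a - c), sq_nonneg (b - c)]

/-! ### Inf-sup stability of the mixed form -/

section Stability

variable [∀ k, CompleteSpace (W k)] {X : HilbertComplex W} {k : ℤ} {K : ℝ}

/-- The test triple is explicit, built from the Hodge decomposition `e = D ρ + h + z`. It makes the
form a sum of squares, apart from one cross term `⟪s, ρ⟫`; the missing `z` is controlled by `D e`
through the Poincaré inequality. -/
theorem exists_mixedForm_ge (hK : 1 ≤ K)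
    (hP : ∀ v : X.V k, (v : W k) ∈ (X.Z k)ᗮ → X.vnorm v ≤ K * ‖X.D k v‖)
    (hP' : ∀ v : X.V (k + 1), (v : W (k + 1)) ∈ (X.Z (k + 1))ᗮ →
      X.vnorm v ≤ K * ‖X.D (k + 1) v‖)
    (s : X.V k) (e : X.V (k + 1)) {r : X.V (k + 1)} (hr : r ∈ X.harmonic k) :
    ∃ (τ : X.V k) (v q : X.V (k + 1)), q ∈ X.harmonic k ∧
      X.vnorm τ + X.vnorm v + ‖q‖ ≤ 5 * (X.vnorm s + X.vnorm e + ‖r‖) ∧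
      (X.vnorm s + X.vnorm e + ‖r‖) ^ 2 ≤ 6 * K ^ 2 * X.mixedForm s e r τ v q := by
  obtain ⟨ρ, h, z, hh, hz, hρ, he⟩ := exists_hodge hP e
  have hK0 : 0 < K := by linarith
  have hDe : X.D (k + 1) e = X.D (k + 1) z := by
    rw [he]; simp [D_D, D_harmonic X hh]
  have hzb := hP' z hz
  have i1 : inner ℝ (X.D k ρ) h = 0 := X.inner_D_harmonic hh ρ
  have i2 : inner ℝ (X.D k ρ) z = 0 := X.inner_eq_zero_of_mem_Z_orthogonal (X.D_D ρ) hz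
  have i3 : inner ℝ h z = 0 := X.inner_eq_zero_of_mem_Z_orthogonal (X.D_harmonic hh) hz
  have i4 : inner ℝ (X.D k s) r = 0 := X.inner_D_harmonic hr s
  have hen : ‖e‖ ^ 2 = ‖X.D k ρ‖ ^ 2 + ‖h‖ ^ 2 + ‖z‖ ^ 2 := by
    rw [he, norm_add_sq_real, norm_add_sq_real, inner_add_left, i1, i2, i3]; ring
  have hρe : inner ℝ (X.D k ρ) e = ‖X.D k ρ‖ ^ 2 := by
    rw [he, inner_add_right, inner_add_right, i1, i2, real_inner_self_eq_norm_sq]; ring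
  have heh : inner ℝ e h = ‖h‖ ^ 2 := by
    rw [he, inner_add_left, inner_add_left, i1, real_inner_comm h z, i3,
      real_inner_self_eq_norm_sq]; ring
  have hs2 := X.vnorm_sq s
  have he2 := X.vnorm_sq e
  have hvs := X.vnorm_nonneg s
  have hve := X.vnorm_nonneg e
  have hvρ := X.vnorm_nonneg ρ
  have ns := X.norm_le_vnorm s
  have nds := X.norm_D_le_vnorm s
  have hne := X.norm_le_vnorm e
  have nde := X.norm_D_le_vnorm e
  have nρ := X.norm_le_vnorm ρ
  have ndρ := X.norm_D_le_vnorm ρ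
  have nz := (X.norm_le_vnorm z).trans hzb
  have hρn : ‖X.D k ρ‖ ≤ ‖e‖ := abs_le_of_sq_le_sq' (by nlinarith [sq_nonneg ‖h‖, sq_nonneg ‖z‖])
    (norm_nonneg _) |>.2
  have hhn : ‖h‖ ≤ ‖e‖ := abs_le_of_sq_le_sq' (by nlinarith [sq_nonneg ‖X.D k ρ‖, sq_nonneg ‖z‖])
    (norm_nonneg _) |>.2
  have hKK : 1 ≤ K ^ 2 := one_le_pow₀ hK
  have hρK : (K ^ 2)⁻¹ * X.vnorm ρ ≤ ‖e‖ := by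
    rw [inv_mul_le_iff₀ (by positivity)]
    nlinarith [norm_nonneg (X.D k ρ), norm_nonneg e]
  -- The factor `(K ^ 2)⁻¹` lets Young's inequality absorb `⟪s, ρ⟫` into half of `‖s‖ ^ 2` and half
  -- of `(K ^ 2)⁻¹ * ‖D ρ‖ ^ 2`.
  refine ⟨s - (K ^ 2)⁻¹ • ρ, e + X.D k s + r, r - h, Submodule.sub_mem _ hr hh, ?_, ?_⟩
  · have t1 : X.vnorm (s - (K ^ 2)⁻¹ • ρ) ≤ 2 * X.vnorm s + 2 * X.vnorm e := by
      have a1 := norm_sub_le s ((K ^ 2)⁻¹ • ρ)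
      have a2 := norm_sub_le (X.D k s) ((K ^ 2)⁻¹ • X.D k ρ)
      rw [norm_smul, Real.norm_eq_abs, abs_of_pos (by positivity)] at a1 a2
      have a3 := X.vnorm_le_add (s - (K ^ 2)⁻¹ • ρ)
      rw [map_sub, map_smul] at a3
      have a4 : (K ^ 2)⁻¹ * ‖ρ‖ ≤ (K ^ 2)⁻¹ * X.vnorm ρ :=
        mul_le_mul_of_nonneg_left nρ (by positivity)
      have a5 : (K ^ 2)⁻¹ * ‖X.D k ρ‖ ≤ (K ^ 2)⁻¹ * X.vnorm ρ :=
        mul_le_mul_of_nonneg_left ndρ (by positivity)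
      linarith
    have t2 : X.vnorm (e + X.D k s + r) ≤ 2 * X.vnorm e + X.vnorm s + ‖r‖ := by
      have a1 := norm_add₃_le (a := e) (b := X.D k s) (c := r)
      have a3 := X.vnorm_le_add (e + X.D k s + r)
      rw [map_add, map_add, D_D, D_harmonic X hr, add_zero, add_zero] at a3
      linarith
    have t3 := norm_sub_le r h
    linarith [norm_nonneg r]
  · have hform : X.mixedForm s e r (s - (K ^ 2)⁻¹ • ρ) (e + X.D k s + r) (r - h)
        = ‖s‖ ^ 2 + ‖X.D k s‖ ^ 2 + ‖X.D (k + 1) e‖ ^ 2 + ‖r‖ ^ 2 + ‖h‖ ^ 2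
          + (K ^ 2)⁻¹ * (‖X.D k ρ‖ ^ 2 - inner ℝ s ρ) := by
      simp only [mixedForm, map_sub, map_add, map_smul, D_D, D_harmonic X hr, inner_sub_right,
        inner_add_right, inner_sub_left, inner_add_left, real_inner_smul_left,
        real_inner_smul_right, inner_zero_right, hρe, heh, i4, real_inner_self_eq_norm_sq]
      ring
    rw [hform]
    have hb : ‖X.D k ρ‖ ^ 2 - K ^ 2 * ‖s‖ ^ 2
        ≤ 2 * K ^ 2 * ((K ^ 2)⁻¹ * (‖X.D k ρ‖ ^ 2 - inner ℝ s ρ)) := by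
      have b1 := real_inner_le_norm s ρ
      have b2 : ‖s‖ * ‖ρ‖ ≤ ‖s‖ * (K * ‖X.D k ρ‖) :=
        mul_le_mul_of_nonneg_left (nρ.trans hρ) (norm_nonneg _)
      have b3 := two_mul_le_add_sq (K * ‖s‖) ‖X.D k ρ‖
      rw [mul_pow] at b3
      rw [mul_assoc, mul_inv_cancel_left₀ (by positivity)]
      linarith
    have hz2 : ‖z‖ ^ 2 ≤ K ^ 2 * ‖X.D (k + 1) e‖ ^ 2 := by
      rw [hDe, ← mul_pow]; exact pow_le_pow_left₀ (norm_nonneg _) nz 2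
    have hsq : (X.vnorm s + X.vnorm e + ‖r‖) ^ 2
        ≤ 3 * (X.vnorm s ^ 2 + X.vnorm e ^ 2 + ‖r‖ ^ 2) := add_three_sq_le _ _ _
    have m : ∀ x : ℝ, x ^ 2 ≤ K ^ 2 * x ^ 2 := fun x => le_mul_of_one_le_left (sq_nonneg x) hKK
    have := m ‖s‖
    have := m ‖X.D k s‖
    have := m ‖X.D (k + 1) e‖
    have := m ‖r‖
    have := m ‖h‖
    have := sq_nonneg ‖X.D k s‖
    have := sq_nonneg ‖r‖
    have := sq_nonneg ‖h‖
    linarith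

/-- The inf-sup condition for the mixed formulation, with a normalized test triple. -/
theorem exists_infSup (hK : 1 ≤ K)
    (hP : ∀ v : X.V k, (v : W k) ∈ (X.Z k)ᗮ → X.vnorm v ≤ K * ‖X.D k v‖)
    (hP' : ∀ v : X.V (k + 1), (v : W (k + 1)) ∈ (X.Z (k + 1))ᗮ →
      X.vnorm v ≤ K * ‖X.D (k + 1) v‖)
    (s : X.V k) (e : X.V (k + 1)) {r : X.V (k + 1)} (hr : r ∈ X.harmonic k) :
    ∃ (τ : X.V k) (v q : X.V (k + 1)), q ∈ X.harmonic k ∧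
      (Nontrivial (X.V k) ∨ Nontrivial (X.V (k + 1)) → X.vnorm τ + X.vnorm v + ‖q‖ = 1) ∧
      X.vnorm τ + X.vnorm v + ‖q‖ ≤ 1 ∧
      X.vnorm s + X.vnorm e + ‖r‖ ≤ 30 * K ^ 2 * X.mixedForm s e r τ v q := by
  have hS : 0 ≤ X.vnorm s + X.vnorm e + ‖r‖ :=
    add_nonneg (add_nonneg (X.vnorm_nonneg s) (X.vnorm_nonneg e)) (norm_nonneg r)
  rcases hS.eq_or_lt with h0 | hpos
  -- With zero error the form vanishes, so any unit triple serves, if one exists.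
  · have hs : s = 0 := X.vnorm_eq_zero
      (by linarith [X.vnorm_nonneg s, X.vnorm_nonneg e, norm_nonneg r])
    have he : e = 0 := X.vnorm_eq_zero
      (by linarith [X.vnorm_nonneg s, X.vnorm_nonneg e, norm_nonneg r])
    have hr0 : r = 0 := norm_eq_zero.1
      (by linarith [X.vnorm_nonneg s, X.vnorm_nonneg e, norm_nonneg r])
    have hform : ∀ (τ : X.V k) (v q : X.V (k + 1)), X.mixedForm s e r τ v q = 0 := by
      simp [mixedForm, hs, he, hr0]
    simp only [hform, ← h0, mul_zero, le_refl, and_true]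
    rcases subsingleton_or_nontrivial (X.V k) with h1 | h1
    · rcases subsingleton_or_nontrivial (X.V (k + 1)) with h2 | h2
      · refine ⟨0, 0, 0, Submodule.zero_mem _, ?_, by simp⟩
        rintro (h | h)
        · exact absurd h1 (not_subsingleton_iff_nontrivial.2 h)
        · exact absurd h2 (not_subsingleton_iff_nontrivial.2 h)
      · obtain ⟨v, hv⟩ := X.exists_vnorm_eq_one (k := k + 1)
        exact ⟨0, v, 0, Submodule.zero_mem _, by simp [hv], by simp [hv]⟩
    · obtain ⟨τ, hτ⟩ := X.exists_vnorm_eq_one (k := k)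
      exact ⟨τ, 0, 0, Submodule.zero_mem _, by simp [hτ], by simp [hτ]⟩
  · obtain ⟨τ, v, q, hq, hT, hB⟩ := exists_mixedForm_ge hK hP hP' s e hr
    set S := X.vnorm s + X.vnorm e + ‖r‖ with hSdef
    set T := X.vnorm τ + X.vnorm v + ‖q‖ with hTdef
    have hK2 : 0 < 6 * K ^ 2 := by positivity
    have hBpos : 0 < X.mixedForm s e r τ v q := by
      have : 0 < 6 * K ^ 2 * X.mixedForm s e r τ v q := lt_of_lt_of_le (by positivity) hB
      exact (mul_pos_iff_of_pos_left hK2).1 this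
    have hT0 : 0 ≤ T := add_nonneg (add_nonneg (X.vnorm_nonneg τ) (X.vnorm_nonneg v))
      (norm_nonneg q)
    have hTpos : 0 < T := by
      refine lt_of_le_of_ne hT0 fun h => ?_
      have hτ : τ = 0 := X.vnorm_eq_zero
        (by linarith [X.vnorm_nonneg τ, X.vnorm_nonneg v, norm_nonneg q])
      have hv : v = 0 := X.vnorm_eq_zero
        (by linarith [X.vnorm_nonneg τ, X.vnorm_nonneg v, norm_nonneg q])
      have hq0 : q = 0 := norm_eq_zero.1
        (by linarith [X.vnorm_nonneg τ, X.vnorm_nonneg v, norm_nonneg q])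
      simp [mixedForm, hτ, hv, hq0] at hBpos
    have hone : X.vnorm (T⁻¹ • τ) + X.vnorm (T⁻¹ • v) + ‖T⁻¹ • q‖ = 1 := by
      rw [vnorm_smul, vnorm_smul, norm_smul, Real.norm_eq_abs, ← mul_add, ← mul_add,
        abs_of_pos (inv_pos.2 hTpos), ← hTdef, inv_mul_cancel₀ hTpos.ne']
    refine ⟨T⁻¹ • τ, T⁻¹ • v, T⁻¹ • q, Submodule.smul_mem _ _ hq, fun _ => hone, hone.le, ?_⟩
    rw [mixedForm_smul, mul_left_comm, le_inv_mul_iff₀ hTpos]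
    nlinarith

end Stability

/-! ### Discrete cycles and harmonic forms -/

namespace Subcomplex

variable {X : HilbertComplex W} (S : X.Subcomplex) {k : ℤ}

theorem Zh_le (k : ℤ) : S.Zh k ≤ S.Vh k := inf_le_left

instance (k : ℤ) : FiniteDimensional ℝ (S.Zh k) :=
  inferInstanceAs (FiniteDimensional ℝ (S.Vh k ⊓ LinearMap.ker (X.D k) : Submodule ℝ (X.V k)))

instance (k : ℤ) : FiniteDimensional ℝ (S.harmonic k) :=
  inferInstanceAs (FiniteDimensional ℝ
    (S.Zh (k + 1) ⊓ ((S.Vh k).map (X.D k))ᗮ : Submodule ℝ (X.V (k + 1))))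

theorem D_mem_Zh {τ : X.V k} (hτ : τ ∈ S.Vh k) : X.D k τ ∈ S.Zh (k + 1) :=
  ⟨S.map_mem k τ hτ, X.D_D τ⟩

theorem D_eq_zero_of_mem_Zh {z : X.V k} (hz : z ∈ S.Zh k) : X.D k z = 0 := hz.2

theorem mem_harmonic_iff {q : X.V (k + 1)} :
    q ∈ S.harmonic k ↔ q ∈ S.Zh (k + 1) ∧ ∀ τ ∈ S.Vh k, inner ℝ (X.D k τ) q = 0 := by
  rw [harmonic, Submodule.mem_inf, Submodule.mem_orthogonal]
  exact and_congr_right fun _ => ⟨fun h τ hτ => h _ ⟨τ, hτ, rfl⟩, fun h _ ⟨τ, hτ, e⟩ => e ▸ h τ hτ⟩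

theorem inner_perpPart {u z : X.V k} (hz : z ∈ S.Zh k) : inner ℝ z (S.perpPart u) = 0 :=
  (Submodule.mem_orthogonal _ _).1 ((S.ZhPerp k).starProjection_apply_mem u).2 z hz

theorem sub_perpPart_mem {u : X.V k} (hu : u ∈ S.Vh k) : u - S.perpPart u ∈ S.Zh k := by
  have hp := (S.Zh k).starProjection_apply_mem u
  have h1 : u - (S.Zh k).starProjection u ∈ S.ZhPerp k :=
    ⟨Submodule.sub_mem _ hu (S.Zh_le k hp), (S.Zh k).sub_starProjection_mem_orthogonal u⟩
  -- Inside `Vh`, projecting onto the complement of the discrete kernel amounts to subtracting the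
  -- projection onto that kernel.
  have h2 : S.perpPart u = u - (S.Zh k).starProjection u := by
    refine Submodule.eq_starProjection_of_mem_of_inner_eq_zero h1 fun w hw => ?_
    rw [sub_sub_cancel]
    exact (Submodule.mem_orthogonal _ _).1 hw.2 _ hp
  rwa [h2, sub_sub_cancel]

theorem norm_perpPart_le (u : X.V k) : ‖S.perpPart u‖ ≤ ‖u‖ :=
  (S.ZhPerp k).norm_starProjection_apply_le u

/-- A discrete cycle orthogonal to the discrete harmonic forms is a discrete boundary. -/
theorem exists_D_eq_of_orthogonal {z : X.V (k + 1)} (hz : z ∈ S.Zh (k + 1))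
    (h : ∀ q ∈ S.harmonic k, inner ℝ z q = 0) : ∃ τ ∈ S.Vh k, X.D k τ = z := by
  set B := (S.Vh k).map (X.D k) with hB
  have hp := B.starProjection_apply_mem z
  obtain ⟨τ, hτ, hτz⟩ := hp
  have hq : z - B.starProjection z ∈ S.harmonic k :=
    ⟨Submodule.sub_mem _ hz (hτz ▸ S.D_mem_Zh hτ), B.sub_starProjection_mem_orthogonal z⟩
  have h0 : inner ℝ (B.starProjection z) (z - B.starProjection z) = 0 :=
    (Submodule.mem_orthogonal _ _).1 hq.2 _ ⟨τ, hτ, hτz⟩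
  refine ⟨τ, hτ, ?_⟩
  have : inner ℝ (z - B.starProjection z) (z - B.starProjection z) = 0 := by
    rw [inner_sub_left, h _ hq, h0, sub_zero]
  rw [hτz]
  exact (sub_eq_zero.1 (inner_self_eq_zero.1 this)).symm

/-- The difference `u - perpPart u` is a discrete cycle orthogonal to the discrete harmonic forms,
hence a boundary, hence orthogonal to `q`. -/
theorem inner_perpPart_harmonic {u q : X.V (k + 1)} (hu : u ∈ S.Vh (k + 1))
    (h : ∀ q ∈ S.harmonic k, inner ℝ u q = 0) (hq : q ∈ X.harmonic k) :
    inner ℝ (S.perpPart u) q = inner ℝ u q := by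
  obtain ⟨τ, -, hτ⟩ := S.exists_D_eq_of_orthogonal (S.sub_perpPart_mem hu) fun q hq => by
    rw [inner_sub_left, h q hq, real_inner_comm, S.inner_perpPart hq.1, sub_zero]
  have h0 := X.inner_D_harmonic hq τ
  rw [hτ, inner_sub_left] at h0
  linarith

theorem CochainOperator.inner_D_err {S : X.Subcomplex} (π : S.CochainOperator) {w : X.V (k + 1)}
    (hw : ∀ τ ∈ S.Vh k, inner ℝ w (X.D k τ) = 0) (ψ : X.V k) :
    inner ℝ w (X.D k (π.err ψ)) = inner ℝ w (X.D k ψ) := by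
  rw [err, map_sub, inner_sub_right, hw _ (π.toFun k ψ).2, sub_zero]

theorem inner_le_vnorm_of_unit {F : X.V k →ₗ[ℝ] ℝ} {a : ℝ}
    (h : ∀ ψ, X.vnorm ψ = 1 → F ψ ≤ a) (ψ : X.V k) : F ψ ≤ a * X.vnorm ψ := by
  by_cases h0 : X.vnorm ψ = 0
  · rw [h0, X.vnorm_eq_zero h0]; simp
  · have := h _ (X.vnorm_inv_smul h0)
    rwa [map_smul, smul_eq_mul,
      inv_mul_le_iff₀ (lt_of_le_of_ne (X.vnorm_nonneg ψ) (Ne.symm h0)), mul_comm] at this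

end Subcomplex

end HilbertComplex
namespace HilbertComplex

variable {W : ℤ → Type*} [∀ k, NormedAddCommGroup (W k)] [∀ k, InnerProductSpace ℝ (W k)]

theorem exists_unit_smul_eq (X : HilbertComplex W) {k : ℤ} (ρ : X.V k) :
    ∃ φ : X.V k, (Nontrivial (X.V k) → X.vnorm φ = 1) ∧ ρ = X.vnorm ρ • φ := by
  by_cases h : X.vnorm ρ = 0
  · rcases subsingleton_or_nontrivial (X.V k) with h1 | h1
    · exact ⟨0, fun h2 => absurd h1 (not_subsingleton_iff_nontrivial.2 h2),
        Subsingleton.elim _ _⟩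
    · obtain ⟨φ, hφ⟩ := X.exists_vnorm_eq_one (k := k)
      exact ⟨φ, fun _ => hφ, by rw [h, zero_smul, X.vnorm_eq_zero h]⟩
  · exact ⟨_, fun _ => X.vnorm_inv_smul h, by rw [smul_smul, mul_inv_cancel₀ h, one_smul]⟩

/-! ### Distance to the complement of the cycles -/

section Distance

variable [∀ k, CompleteSpace (W k)] (X : HilbertComplex W) {k : ℤ}

theorem distZPerp_nonneg (w : X.V k) : 0 ≤ X.distZPerp w := norm_nonneg _

theorem distZPerp_le_norm (w : X.V k) : X.distZPerp w ≤ ‖w‖ := by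
  have := norm_sq_sub_starProjection (X.Z k)ᗮ (w : W k)
  exact abs_le_of_sq_le_sq' (this.trans_le (sub_le_self _ (sq_nonneg _))) (norm_nonneg _) |>.2

theorem inner_le_distZPerp (w : X.V k) {y : X.V k} (hy : X.D k y = 0) :
    inner ℝ w y ≤ X.distZPerp w * ‖y‖ := by
  have h : inner ℝ ((X.Z k)ᗮ.starProjection (w : W k)) (y : W k) = 0 := by
    rw [real_inner_comm]
    exact (Submodule.mem_orthogonal _ _).1 ((X.Z k)ᗮ.starProjection_apply_mem (w : W k)) _
      (X.coe_mem_Z.2 hy)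
  calc inner ℝ w y = inner ℝ ((w : W k) - (X.Z k)ᗮ.starProjection (w : W k)) (y : W k) := by
        rw [inner_sub_left, h, sub_zero]; rfl
    _ ≤ _ := real_inner_le_norm _ _

theorem distZPerp_add {y z : X.V k} (hy : X.D k y = 0) (hz : (z : W k) ∈ (X.Z k)ᗮ) :
    X.distZPerp (y + z) = ‖y‖ := by
  have : (X.Z k)ᗮ.starProjection ((y + z : X.V k) : W k) = z := by
    refine Submodule.eq_starProjection_of_mem_of_inner_eq_zero hz fun w hw => ?_
    rw [Submodule.coe_add, add_sub_cancel_right]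
    exact (Submodule.mem_orthogonal _ _).1 hw _ (X.coe_mem_Z.2 hy)
  rw [distZPerp, this, Submodule.coe_add, add_sub_cancel_right, Submodule.norm_coe]

end Distance

/-! ### Galerkin orthogonality and the nonconformity terms -/

namespace Subcomplex

variable {X : HilbertComplex W} {S : X.Subcomplex} {k : ℤ} {K : ℝ}

/-- Here `‖D ρ‖ ^ 2 = ⟪w, D ρ⟫ = ⟪w, D (ρ - π ρ)⟫ ≤ a * ‖ρ‖_V ≤ |a| * K * ‖D ρ‖`, and one factor
cancels. It serves `ph`, the discrete harmonic basis and `perpPart uh` alike. -/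
theorem CochainOperator.norm_D_le (π : S.CochainOperator) (hK : 0 ≤ K) {w : X.V (k + 1)}
    (hw : ∀ τ ∈ S.Vh k, inner ℝ w (X.D k τ) = 0) {ρ : X.V k} {a : ℝ}
    (hρ : X.vnorm ρ ≤ K * ‖X.D k ρ‖) (hwρ : inner ℝ w (X.D k ρ) = ‖X.D k ρ‖ ^ 2)
    (ha : inner ℝ w (X.D k (π.err ρ)) ≤ a * X.vnorm ρ) : ‖X.D k ρ‖ ≤ K * |a| := by
  rw [π.inner_D_err hw, hwρ] at ha
  rcases (norm_nonneg (X.D k ρ)).eq_or_lt with h | h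
  · rw [← h]; positivity
  · refine le_of_mul_le_mul_right ?_ h
    calc ‖X.D k ρ‖ * ‖X.D k ρ‖ ≤ a * X.vnorm ρ := by rw [← sq]; exact ha
      _ ≤ |a| * (K * ‖X.D k ρ‖) :=
        mul_le_mul (le_abs_self a) hρ (X.vnorm_nonneg ρ) (abs_nonneg a)
      _ = K * |a| * ‖X.D k ρ‖ := by ring

theorem CochainOperator.inner_D_err_le (π : S.CochainOperator) {w : X.V (k + 1)} {a : ℝ}
    (ha : ∀ ψ : X.V k, X.vnorm ψ = 1 → inner ℝ w (X.D k (π.err ψ)) ≤ a) (ψ : X.V k) :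
    inner ℝ w (X.D k (π.err ψ)) ≤ a * X.vnorm ψ :=
  inner_le_vnorm_of_unit (F := (innerₛₗ ℝ w).comp
    ((X.D k).comp (LinearMap.id - (S.Vh k).subtype.comp (π.toFun k)))) ha ψ

theorem inner_D_eq_zero {q : X.V (k + 1)} (hq : q ∈ S.harmonic k) :
    ∀ τ ∈ S.Vh k, inner ℝ q (X.D k τ) = 0 := fun τ hτ => by
  rw [real_inner_comm]; exact (S.mem_harmonic_iff.1 hq).2 τ hτ

theorem finrank_harmonic_eq (h : Module.rank ℝ (X.harmonic k) = Module.rank ℝ (S.harmonic k)) :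
    FiniteDimensional ℝ (X.harmonic k) ∧
      Module.finrank ℝ (X.harmonic k) = Module.finrank ℝ (S.harmonic k) :=
  ⟨Module.rank_lt_aleph0_iff.1 (h ▸ Module.rank_lt_aleph0 ℝ (S.harmonic k)),
    congrArg Cardinal.toNat h⟩

/-- The mixed form of the error, by Galerkin orthogonality. -/
theorem CochainOperator.mixedForm_error (π : S.CochainOperator) {f : W (k + 1)} {σ σh : X.V k}
    {u uh p ph : X.V (k + 1)} (hX : X.IsSolution f σ u p) (hS : S.IsSolution f σh uh ph)
    {y h : X.V (k + 1)} (hph : ph = y + h) (τ : X.V k) (v : X.V (k + 1)) {q : X.V (k + 1)}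
    (hq : q ∈ X.harmonic k) :
    X.mixedForm (σ - σh) (u - uh) (p - h) τ v q
      = (inner ℝ (σ - σh) (π.err τ) - inner ℝ (X.D k (π.err τ)) (u - uh))
        + (inner ℝ (f - (X.D k σh : W (k + 1)) - (ph : W (k + 1))) (π.err v : W (k + 1))
            - inner ℝ (X.D (k + 1) uh) (X.D (k + 1) (π.err v)))
        + inner ℝ v y + inner ℝ uh q := by
  -- Both systems hold on the images of `π`, so `τ` and `v` may be replaced by their errors. Using
  -- `h = ph - y` produces `⟪v, y⟫`, and `⟪u, q⟫ = 0` leaves `⟪uh, q⟫`.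
  have a1 := hX.eq_sigma (π.toFun k τ)
  have a2 := hS.eq_sigma _ (π.toFun k τ).2
  have a3 := hX.eq_sigma τ
  have b1 := hS.eq_u _ (π.toFun (k + 1) v).2
  have b2 := hX.eq_u v
  have c1 := hX.orthogonal q hq
  have e1 : ∀ a b : X.V (k + 1), inner ℝ (a : W (k + 1)) (b : W (k + 1)) = inner ℝ a b :=
    fun _ _ => rfl
  have h1 : h = ph - y := by rw [hph, add_sub_cancel_left]
  have s1 := real_inner_comm ph (π.toFun (k + 1) v : X.V (k + 1))
  have s2 := real_inner_comm ph v
  simp only [mixedForm, err, h1, map_sub, inner_sub_left, inner_sub_right, AddSubgroupClass.coe_sub,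
    e1] at *
  linarith

variable [∀ k, CompleteSpace (W k)]

/-- Harmonic forms are close to the discrete harmonic forms. -/
theorem CochainOperator.norm_sub_starProjection_harmonic_le (π : S.CochainOperator) (hK : 0 ≤ K)
    (hP : ∀ v : X.V k, (v : W k) ∈ (X.Z k)ᗮ → X.vnorm v ≤ K * ‖X.D k v‖)
    (hrank : Module.rank ℝ (X.harmonic k) = Module.rank ℝ (S.harmonic k))
    {M : ℕ} (b : OrthonormalBasis (Fin M) ℝ (S.harmonic k)) {m : Fin M → ℝ} {c : ℝ} (hc : 0 ≤ c)
    (hm : ∀ i, ∀ ψ : X.V k, X.vnorm ψ = 1 →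
      inner ℝ (b i : X.V (k + 1)) (X.D k (π.err ψ)) ≤ c * m i)
    {q : X.V (k + 1)} (hq : q ∈ X.harmonic k) :
    ‖q - (S.harmonic k).starProjection q‖ ≤ K * c * Real.sqrt (∑ i, m i ^ 2) * ‖q‖ := by
  obtain ⟨hfin, hrk⟩ := finrank_harmonic_eq hrank
  -- The sign of `m i` is not prescribed, hence the absolute value; only its square survives.
  have key := norm_sub_starProjection_le_of_basis hrk b (m := fun i => K * |c * m i|)
    (fun i => by
      obtain ⟨ρ, h, hh, hρ, hb⟩ := exists_hodge_closed hP (S.D_eq_zero_of_mem_Zh (b i).2.1)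
      refine ⟨h, hh, ?_⟩
      rw [hb, add_sub_cancel_right]
      refine π.norm_D_le hK (inner_D_eq_zero (b i).2) hρ ?_ (π.inner_D_err_le (hm i) ρ)
      rw [hb, inner_add_left, real_inner_comm _ h, X.inner_D_harmonic hh, add_zero,
        real_inner_self_eq_norm_sq]) hq
  have : Real.sqrt (∑ i, (K * |c * m i|) ^ 2) = K * c * Real.sqrt (∑ i, m i ^ 2) := by
    simp only [mul_pow, sq_abs, ← Finset.mul_sum, ← mul_assoc]
    rw [← mul_pow, Real.sqrt_mul (by positivity), Real.sqrt_sq (by positivity)]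
  rwa [this] at key

/-- The component of the discrete solution along the harmonic forms, estimated by the gap
between the harmonic and the discrete harmonic forms. -/
theorem inner_perpPart_harmonic_le (u : X.V (k + 1)) {q : X.V (k + 1)} (hq : q ∈ X.harmonic k) :
    inner ℝ (S.perpPart u) q
      ≤ X.distZPerp (S.perpPart u) * ‖q - (S.harmonic k).starProjection q‖ := by
  have hp := (S.harmonic k).starProjection_apply_mem q
  have h0 : inner ℝ (S.perpPart u) ((S.harmonic k).starProjection q) = 0 := by
    rw [real_inner_comm]; exact S.inner_perpPart hp.1
  have h1 : X.D (k + 1) (q - (S.harmonic k).starProjection q) = 0 := by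
    rw [map_sub, X.D_harmonic hq, S.D_eq_zero_of_mem_Zh hp.1, sub_zero]
  have := X.inner_le_distZPerp (S.perpPart u) h1
  rwa [inner_sub_right, h0, sub_zero] at this

/-- The distance is the norm of the cycle part `D ρ + h` of `perpPart u`. The boundary part is
bounded by `norm_D_le`; for the harmonic part, `‖h‖ ^ 2 = ⟪perpPart u, h⟫` picks up the gap `δ`,
because `perpPart u` is orthogonal to the discrete harmonic forms. -/
theorem CochainOperator.distZPerp_perpPart_le (π : S.CochainOperator) (hK : 0 ≤ K)
    (hP : ∀ v : X.V k, (v : W k) ∈ (X.Z k)ᗮ → X.vnorm v ≤ K * ‖X.D k v‖) (u : X.V (k + 1))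
    {δ a : ℝ} (hδ : 0 ≤ δ)
    (hgap : ∀ q ∈ X.harmonic k, ‖q - (S.harmonic k).starProjection q‖ ≤ δ * ‖q‖)
    (ha : ∀ ψ : X.V k, X.vnorm ψ = 1 → inner ℝ (S.perpPart u) (X.D k (π.err ψ)) ≤ a) :
    X.distZPerp (S.perpPart u) ≤ K * |a| + δ * ‖u‖ := by
  obtain ⟨ρ, h, z, hh, hz, hρ, he⟩ := exists_hodge hP (S.perpPart u)
  have hc : X.D (k + 1) (X.D k ρ + h) = 0 := by
    rw [map_add, X.D_D, X.D_harmonic hh, add_zero]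
  have hdist : X.distZPerp (S.perpPart u) = ‖X.D k ρ + h‖ := by
    rw [he]; exact X.distZPerp_add hc hz
  have i1 : inner ℝ (X.D k ρ) h = 0 := X.inner_D_harmonic hh ρ
  have i2 : inner ℝ (X.D k ρ) z = 0 := X.inner_eq_zero_of_mem_Z_orthogonal (X.D_D ρ) hz
  have i3 : inner ℝ h z = 0 := X.inner_eq_zero_of_mem_Z_orthogonal (X.D_harmonic hh) hz
  have hDρ : ‖X.D k ρ‖ ≤ K * |a| := by
    refine π.norm_D_le hK (fun τ hτ => ?_) hρ ?_ (π.inner_D_err_le ha ρ)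
    · rw [real_inner_comm]; exact S.inner_perpPart (S.D_mem_Zh hτ)
    · rw [real_inner_comm, he, inner_add_right, inner_add_right, i1, i2,
        real_inner_self_eq_norm_sq, add_zero, add_zero]
  have hsq : ‖h‖ ^ 2 = inner ℝ (S.perpPart u) h := by
    rw [real_inner_comm, he, inner_add_right, inner_add_right, i3, real_inner_comm, i1,
      real_inner_self_eq_norm_sq, zero_add, add_zero]
  have hd : X.distZPerp (S.perpPart u) ≤ ‖u‖ :=
    (X.distZPerp_le_norm _).trans (S.norm_perpPart_le u)
  have hhn : ‖h‖ ≤ δ * ‖u‖ := by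
    rcases (norm_nonneg h).eq_or_lt with h0 | h0
    · rw [← h0]; positivity
    · refine le_of_mul_le_mul_right ?_ h0
      calc ‖h‖ * ‖h‖ ≤ X.distZPerp (S.perpPart u) * ‖h - (S.harmonic k).starProjection h‖ := by
            rw [← sq, hsq]; exact inner_perpPart_harmonic_le u hh
        _ ≤ ‖u‖ * (δ * ‖h‖) := mul_le_mul hd (hgap h hh) (norm_nonneg _) (norm_nonneg _)
        _ = δ * ‖u‖ * ‖h‖ := by ring
  rw [hdist]
  exact (norm_add_le _ _).trans (add_le_add hDρ hhn)

end Subcomplex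

end HilbertComplex

/-! ### The a posteriori error estimate -/

theorem lemma2p3 (K c : ℝ) (hc : 0 < c) :
    ∃ C : ℝ, 0 < C ∧
      ∀ (W : ℤ → Type*) [∀ k, NormedAddCommGroup (W k)] [∀ k, InnerProductSpace ℝ (W k)]
        [∀ k, CompleteSpace (W k)] (X : HilbertComplex W) (_ : X.CompactnessProperty)
        (k : ℤ) (_ : X.poincareConst k ≤ K) (_ : X.poincareConst (k + 1) ≤ K)
        (S : X.Subcomplex) (π : S.CochainOperator)
        (_ : Module.rank ℝ (X.harmonic k) = Module.rank ℝ (S.harmonic k))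
        (f : W (k + 1)) (σ σh : X.V k) (u uh p ph : X.V (k + 1))
        (_ : X.IsSolution f σ u p) (_ : S.IsSolution f σh uh ph),
      ∃ (τ : X.V k) (v q : X.V (k + 1)) (φ : X.V k),
        q ∈ X.harmonic k ∧
        (Nontrivial (X.V k) ∨ Nontrivial (X.V (k + 1)) → X.vnorm τ + X.vnorm v + ‖q‖ = 1) ∧
        (Nontrivial (X.V k) → X.vnorm φ = 1) ∧
        ∀ (M : ℕ) (b : OrthonormalBasis (Fin M) ℝ (S.harmonic k)) (μ' : Fin M → ℝ) (μ : ℝ),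
          (∀ i, ∀ ψ : X.V k, X.vnorm ψ = 1 →
            inner ℝ (b i : X.V (k + 1)) (X.D k (π.err ψ)) ≤ c * μ' i) →
          μ = Real.sqrt (∑ i, μ' i ^ 2) →
          X.vnorm (σ - σh) + X.vnorm (u - uh) + ‖p - ph‖ ≤
            C * (|inner ℝ (σ - σh) (π.err τ) - inner ℝ (X.D k (π.err τ)) (u - uh)|
              + |inner ℝ (f - (X.D k σh : W (k + 1)) - (ph : W (k + 1))) (π.err v : W (k + 1))
                - inner ℝ (X.D (k + 1) uh) (X.D (k + 1) (π.err v))|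
              + |inner ℝ ph (X.D k (π.err φ))|
              + μ * X.distZPerp (S.perpPart uh)) ∧
          X.distZPerp (S.perpPart uh) ≤ ‖uh‖ ∧
          ∀ ε : ℝ, 0 ≤ ε →
            (∀ ψ : X.V k, X.vnorm ψ = 1 →
              inner ℝ (S.perpPart uh) (X.D k (π.err ψ)) ≤ c * ε) →
            μ * X.distZPerp (S.perpPart uh) ≤ C * (μ * ε + μ ^ 2 * ‖uh‖) := by
  set L : ℝ := max K 1 with hLdef
  have hL1 : 1 ≤ L := le_max_right _ _
  have hL0 : 0 ≤ L := by linarith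
  have hLc : 0 ≤ L * c := by positivity
  -- The first summand is the inf-sup constant times the bound on the form, `L` pays for passing
  -- from `p - h` to `p - ph`, and `L * c` is the constant of the last estimate.
  refine ⟨30 * L ^ 2 * (1 + L + L * c) + L + L * c, by positivity, ?_⟩
  intro W _ _ _ X hcomp k hk hk' S π hrank f σ σh u uh p ph hX hS
  have hP := HilbertComplex.poincare hcomp (hk.trans (le_max_left K 1))
  have hP' := HilbertComplex.poincare hcomp (hk'.trans (le_max_left K 1))
  rw [← hLdef] at hP hP'
  obtain ⟨ρ, h, hh, hρ, hph⟩ := HilbertComplex.exists_hodge_closed hP (S.D_eq_zero_of_mem_Zh hS.mem_harmonic.1)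
  obtain ⟨τ, v, q, hq, hone, hle, hinf⟩ := HilbertComplex.exists_infSup hL1 hP hP' (σ - σh) (u - uh)
    (Submodule.sub_mem _ hX.mem_harmonic hh)
  -- All test elements are fixed here, before the basis and the `μ' i` are introduced.
  obtain ⟨φ, hφ, hρφ⟩ := X.exists_unit_smul_eq ρ
  refine ⟨τ, v, q, φ, hq, hone, hφ, ?_⟩
  intro M b μ' μ hμ' hμ
  have hμ0 : 0 ≤ μ := hμ ▸ Real.sqrt_nonneg _
  have hgap : ∀ q ∈ X.harmonic k, ‖q - (S.harmonic k).starProjection q‖ ≤ L * c * μ * ‖q‖ := by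
    intro q hq
    rw [hμ]
    exact π.norm_sub_starProjection_harmonic_le hL0 hP hrank b hc.le hμ' hq
  have hvn := X.vnorm_nonneg v
  have hτn := X.vnorm_nonneg τ
  have hv1 : ‖v‖ ≤ 1 := (X.norm_le_vnorm v).trans (by linarith [norm_nonneg q])
  have hq1 : ‖q‖ ≤ 1 := by linarith
  have hd0 := X.distZPerp_nonneg (S.perpPart uh)
  have hdle : X.distZPerp (S.perpPart uh) ≤ ‖uh‖ :=
    (X.distZPerp_le_norm _).trans (S.norm_perpPart_le uh)
  refine ⟨?_, hdle, ?_⟩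
  · have hDρ : ‖X.D k ρ‖ ≤ L * |inner ℝ ph (X.D k (π.err φ))| := by
      refine π.norm_D_le hL0 (HilbertComplex.Subcomplex.inner_D_eq_zero hS.mem_harmonic) hρ ?_ ?_
      · rw [hph, inner_add_left, real_inner_comm _ h, X.inner_D_harmonic hh, add_zero,
          real_inner_self_eq_norm_sq]
      · refine le_of_eq ?_
        rw [π.inner_D_err (HilbertComplex.Subcomplex.inner_D_eq_zero hS.mem_harmonic),
          π.inner_D_err (HilbertComplex.Subcomplex.inner_D_eq_zero hS.mem_harmonic)]
        conv_lhs => rw [hρφ]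
        rw [map_smul, inner_smul_right, mul_comm]
    have hp : ‖p - ph‖ ≤ ‖p - h‖ + ‖X.D k ρ‖ := by
      rw [show p - ph = p - h - X.D k ρ by rw [hph]; abel]
      exact norm_sub_le _ _
    have hvρ : inner ℝ v (X.D k ρ) ≤ ‖X.D k ρ‖ :=
      (real_inner_le_norm _ _).trans (mul_le_of_le_one_left (norm_nonneg _) hv1)
    have huq : inner ℝ uh q ≤ L * c * (μ * X.distZPerp (S.perpPart uh)) := by
      rw [← S.inner_perpPart_harmonic hS.mem_u hS.orthogonal hq]
      refine (HilbertComplex.Subcomplex.inner_perpPart_harmonic_le uh hq).trans ?_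
      calc _ ≤ X.distZPerp (S.perpPart uh) * (L * c * μ) :=
            mul_le_mul_of_nonneg_left ((hgap q hq).trans
              (mul_le_of_le_one_right (by positivity) hq1)) hd0
        _ = _ := by ring
    rw [π.mixedForm_error hX hS hph τ v hq] at hinf
    set t₁ := inner ℝ (σ - σh) (π.err τ) - inner ℝ (X.D k (π.err τ)) (u - uh)
    set t₂ := inner ℝ (f - (X.D k σh : W (k + 1)) - (ph : W (k + 1))) (π.err v : W (k + 1))
      - inner ℝ (X.D (k + 1) uh) (X.D (k + 1) (π.err v))
    set t₃ := |inner ℝ ph (X.D k (π.err φ))|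
    set t₄ := μ * X.distZPerp (S.perpPart uh)
    have ht₃ : 0 ≤ t₃ := abs_nonneg _
    have ht₄ : 0 ≤ t₄ := mul_nonneg hμ0 hd0
    have hL2 : 0 ≤ 30 * L ^ 2 := by positivity
    have hsum : t₁ + t₂ + inner ℝ v (X.D k ρ) + inner ℝ uh q
        ≤ (1 + L + L * c) * (|t₁| + |t₂| + t₃ + t₄) := by
      have := mul_nonneg hL0 (add_nonneg (add_nonneg (abs_nonneg t₁) (abs_nonneg t₂)) ht₄)
      have := mul_nonneg hLc (add_nonneg (add_nonneg (abs_nonneg t₁) (abs_nonneg t₂)) ht₃)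
      linarith [le_abs_self t₁, le_abs_self t₂]
    have h1 := mul_le_mul_of_nonneg_left hsum hL2
    have h2 := mul_nonneg hL0 (add_nonneg (add_nonneg (abs_nonneg t₁) (abs_nonneg t₂)) ht₄)
    have h3 := mul_nonneg hLc
      (add_nonneg (add_nonneg (add_nonneg (abs_nonneg t₁) (abs_nonneg t₂)) ht₃) ht₄)
    linarith
  · intro ε hε hψ
    have hd := π.distZPerp_perpPart_le hL0 hP uh (by positivity : 0 ≤ L * c * μ) hgap hψ
    rw [abs_of_nonneg (by positivity)] at hd
    calc μ * X.distZPerp (S.perpPart uh) ≤ μ * (L * (c * ε) + L * c * μ * ‖uh‖) :=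
          mul_le_mul_of_nonneg_left hd hμ0
      _ = L * c * (μ * ε + μ ^ 2 * ‖uh‖) := by ring
      _ ≤ _ := mul_le_mul_of_nonneg_right (le_add_of_nonneg_left (by positivity)) (by positivity)
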